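/- All graphs are finite, simple, undirected and connected. $N(v)$ is the set of neighbours of $v$. For a partial order $\pi$ on a set (a reflexive, antisymmetric, transitive relation), $x\prec_\pi y$ means $(x,y)\in\pi$ and $x\neq y$. A vertex ordering $\sigma$ of a graph $G$ with $n$ vertices is a bijection from $\{1,\dots,n\}$ to $V(G)$; $x\prec_\sigma y$ means that $x$ has a smaller position than $y$; $\sigma$ extends $\pi$ if $x\prec_\pi y$ implies $x\prec_\sigma y$. It is an LBFS ordering if for every $i$ there is no vertex $y\in\{\sigma(i),\dots,\sigma(n)\}$ with $L_i(\sigma(i))\prec_{LBFS}L_i(y)$, where $L_i(v)=\{j<i : \sigma(j)\in N(v)\}$, and $S\prec_{LBFS}T$ means that $S\subsetneq T$, or $S\setminus T$ and $T\setminus S$ are both nonempty and $\min(S\setminus T)>\min(T\setminus S)$. Let $G$ be a split graph with split partition $V(G)=C\,\dot\cup\, I$, where $C$ is a clique and $I$ is an independent set (either may be empty), let $\pi$ be a partial order on $V(G)$, and let $A\subseteq I$. The pair $(\pi,A)$ has the **nested property** if: - (N1) if $y\in C$ and $x\prec_\pi y$, then $x\in C\cup A$; - (N2) there are an integer $k\ge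 0$ and pairwise disjoint nonempty sets $C_1,I_1,\dots,C_k,I_k$ with $\bigcup_{j=1}^k I_j=A$ and $N(x)=\bigcup_{j=1}^{i}C_j$ for all $i$ and all $x\in I_i$ (such sets are uniquely determined by $G$ and $A$ if they exist); - (N3) if $y\in C_i\cup I_i$ and $x\prec_\pi y$, then $x\in C_j\cup I_j$ for some $j\le i$; - (N4) for each $i$ there is at most one $x\in I_i$ for which some $y\in C_i$ satisfies $x\prec_\pi y$. In this case the **nested partial order** $\pi^N(\pi,A)$ is the reflexive and transitive closure of the relation consisting of the pairs - $(x,y)$ with $x\prec_\pi y$; - $(x,y)$ with $x\in I_i\cup C_i$ and $y\in V(G)\setminus\bigcup_{j=1}^i(I_j\cup C_j)$ for some $i$; - $(x,y)$ with $x\in C$ and $y\in I\setminus A$; - $(x,y)$ with $x,y\in I_i$ for some $i$ such that $x\prec_\pi z$ for some $z\in C_i$. For a set $M$, a set $\mathcal Q\subseteq\mathcal P(M)$ and a relation $\mathcal R\subseteq\mathcal Q\times\mathcal Q$, an **OBA (One-Before-All) ordering** for $(M,\mathcal Q,\mathcal R)$ is a linear ordering $\tau$ of $M$ such that for all $(X,Y)\in\mathcal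 R$ with $Y\ne\emptyset$ there is an $x\in X$ with $x\prec_\tau y$ for all $y\in Y$. **Lemma.** Let $G$ be a connected split graph with split partition $(C,I)$ and let $\pi$ be a partial order on $V(G)$. Let $$A=\{u\in I : \exists v\in V(G)\text{ with } (v\in C\text{ or }N(u)\subsetneq N(v))\text{ and }u\prec_\pi v\},$$ let $\pi'=\pi^N(\pi,A)$, and let $$\mathcal R=\{(N(x)\setminus N(y),\,N(y)\setminus N(x)) : x,y\in I\setminus A,\ x\prec_\pi y\}\ \cup\ \{(\{x\},\{y\}) : x,y\in C,\ x\prec_{\pi'}y\}.$$ There is an LBFS ordering of $G$ extending $\pi$ if and only if $(\pi,A)$ has the nested property and there is an OBA ordering for $(C,\mathcal Q,\mathcal R)$, where $\mathcal Q$ is the ground set of $\mathcal R$, i.e. the set of all first and second components of elements of $\mathcal R$. -/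

import Mathlib

namespace SplitLBFS

section Orders

/-- The irreflexive part of a relation: for a partial order `π` this is `x ≺_π y`. -/
def Strict {V : Type*} (π : V → V → Prop) (x y : V) : Prop := π x y ∧ x ≠ y

/-- A vertex ordering: a bijection from the positions (here `0, …, |V| - 1`) to the vertices. -/
abbrev VertexOrdering (V : Type*) [Fintype V] := Fin (Fintype.card V) ≃ V

/-- `u` is to the left of `v` in `σ`. -/
def VertexOrdering.Left {V : Type*} [Fintype V] (σ : VertexOrdering V) (u v : V) : Prop :=
  σ.symm u < σ.symm v

/-- `σ` is a linear extension of `π`. -/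
def VertexOrdering.Extends {V : Type*} [Fintype V] (σ : VertexOrdering V)
    (π : V → V → Prop) : Prop :=
  ∀ x y, Strict π x y → VertexOrdering.Left σ x y

end Orders

section LabelSearch

/-- The label that a vertex `v`, unnumbered when position `i` is about to be filled, carries at
that moment: the set of the numbers `1, 2, …` of the already visited neighbours of `v`
(position `j : Fin n` has the number `j + 1`). -/
def label {V : Type*} [Fintype V] (G : SimpleGraph V) (σ : VertexOrdering V)
    (i : Fin (Fintype.card V)) (v : V) : Set ℕ :=
  {m | ∃ j : Fin (Fintype.card V), j < i ∧ G.Adj (σ j) v ∧ m = (j : ℕ) + 1}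

/-- `σ` is a possible output of the label search with label order `lt`: whenever a vertex is
visited, no unnumbered vertex has a label that is larger with respect to `lt`. -/
def IsLabelSearchOrdering {V : Type*} [Fintype V] (lt : Set ℕ → Set ℕ → Prop)
    (G : SimpleGraph V) (σ : VertexOrdering V) : Prop :=
  ∀ i j : Fin (Fintype.card V), i ≤ j → ¬ lt (label G σ i (σ i)) (label G σ i (σ j))

/-- The label order of LBFS: `A ⊊ B`, or `min (A \ B) > min (B \ A)` (both minima existing). -/
def lbfsLT (A B : Set ℕ) : Prop :=
  A ⊂ B ∨ ∃ a b, IsLeast (A \ B) a ∧ IsLeast (B \ A) b ∧ b < a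

/-- LBFS orderings. -/
def IsLBFSOrdering {V : Type*} [Fintype V] (G : SimpleGraph V) (σ : VertexOrdering V) : Prop :=
  IsLabelSearchOrdering lbfsLT G σ

end LabelSearch

section OneBeforeAll

/-- `τ` is (the strict relation of) a linear ordering of `M` with the One-Before-All property
for `Q` and `R`. -/
def IsOBAOrdering {M : Type*} (Q : Set (Set M)) (R : Set (Set M × Set M))
    (τ : M → M → Prop) : Prop :=
  IsStrictTotalOrder M τ ∧
    ∀ A ∈ Q, ∀ B ∈ Q, (A, B) ∈ R → B.Nonempty → ∃ x ∈ A, ∀ y ∈ B, τ x y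

/-- The ground set of a relation. -/
def groundSet {S : Type*} (R : Set (S × S)) : Set S :=
  {A | ∃ B, (A, B) ∈ R ∨ (B, A) ∈ R}

end OneBeforeAll

section Nested

/-- `(C, I)` is a split partition of `G`. -/
structure IsSplitPartition {V : Type*} (G : SimpleGraph V) (C I : Set V) : Prop where
  disjoint : Disjoint C I
  union_eq : C ∪ I = Set.univ
  clique : G.IsClique C
  indep : G.IsIndepSet I

/-- The ordering by inclusion of the neighbourhoods of the elements of `A`: pairwise disjoint
nonempty sets `C₁, I₁, …, C_k, I_k` such that the `I_i` cover `A` and `N(x) = C₁ ∪ … ∪ C_i` for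
`x ∈ I_i`. -/
@[ext]
structure NeighborhoodLayering {V : Type*} (G : SimpleGraph V) (A : Set V) where
  k : ℕ
  cl : Fin k → Set V
  il : Fin k → Set V
  cl_nonempty : ∀ i, (cl i).Nonempty
  il_nonempty : ∀ i, (il i).Nonempty
  cl_disjoint : ∀ i j, i ≠ j → Disjoint (cl i) (cl j)
  il_disjoint : ∀ i j, i ≠ j → Disjoint (il i) (il j)
  cl_il_disjoint : ∀ i j, Disjoint (cl i) (il j)
  iUnion_il : ⋃ j, il j = A
  neighborSet_eq : ∀ i, ∀ x ∈ il i, G.neighborSet x = ⋃ j, ⋃ (_ : j ≤ i), cl j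

namespace NeighborhoodLayering

variable {V : Type*} {G : SimpleGraph V} {A : Set V}

/-- `C_i ∪ I_i`. -/
def layer (D : NeighborhoodLayering G A) (i : Fin D.k) : Set V := D.cl i ∪ D.il i

/-- `C₁ ∪ … ∪ C_i`. -/
def nbhd (D : NeighborhoodLayering G A) (i : Fin D.k) : Set V := ⋃ j, ⋃ (_ : j ≤ i), D.cl j

theorem nbhd_strictMono (D : NeighborhoodLayering G A) : StrictMono D.nbhd := by
  intro i j hij
  refine ⟨?_, ?_⟩
  · intro x hx
    simp only [nbhd, Set.mem_iUnion, exists_prop] at hx ⊢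
    obtain ⟨l, hl, hx⟩ := hx
    exact ⟨l, hl.trans hij.le, hx⟩
  · intro hsub
    obtain ⟨x, hx⟩ := D.cl_nonempty j
    have h1 : x ∈ D.nbhd j := by
      simp only [nbhd, Set.mem_iUnion, exists_prop]
      exact ⟨j, le_rfl, hx⟩
    have h2 := hsub h1
    simp only [nbhd, Set.mem_iUnion, exists_prop] at h2
    obtain ⟨l, hl, hxl⟩ := h2
    exact Set.disjoint_left.1 (D.cl_disjoint l j (ne_of_lt (lt_of_le_of_lt hl hij))) hxl hx

theorem range_nbhd (D : NeighborhoodLayering G A) :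
    Set.range D.nbhd = (fun x => G.neighborSet x) '' A := by
  ext S
  constructor
  · rintro ⟨i, rfl⟩
    obtain ⟨x, hx⟩ := D.il_nonempty i
    refine ⟨x, ?_, D.neighborSet_eq i x hx⟩
    rw [← D.iUnion_il]
    exact Set.mem_iUnion.2 ⟨i, hx⟩
  · rintro ⟨x, hx, rfl⟩
    rw [← D.iUnion_il] at hx
    obtain ⟨i, hi⟩ := Set.mem_iUnion.1 hx
    exact ⟨i, (D.neighborSet_eq i x hi).symm⟩

theorem il_eq (D : NeighborhoodLayering G A) (i : Fin D.k) :
    D.il i = {x | x ∈ A ∧ G.neighborSet x = D.nbhd i} := by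
  ext x
  constructor
  · intro hx
    refine ⟨?_, D.neighborSet_eq i x hx⟩
    rw [← D.iUnion_il]
    exact Set.mem_iUnion.2 ⟨i, hx⟩
  · rintro ⟨hx, hN⟩
    rw [← D.iUnion_il] at hx
    obtain ⟨j, hj⟩ := Set.mem_iUnion.1 hx
    have h : D.nbhd j = D.nbhd i := (D.neighborSet_eq j x hj).symm.trans hN
    rwa [← D.nbhd_strictMono.injective h]

theorem cl_eq (D : NeighborhoodLayering G A) (i : Fin D.k) :
    D.cl i = D.nbhd i \ ⋃ j, ⋃ (_ : j < i), D.nbhd j := by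
  ext x
  simp only [nbhd, Set.mem_sdiff, Set.mem_iUnion, exists_prop, not_exists, not_and]
  constructor
  · intro hx
    refine ⟨⟨i, le_rfl, hx⟩, fun j hj l hl hxl => ?_⟩
    exact Set.disjoint_left.1 (D.cl_disjoint l i (ne_of_lt (lt_of_le_of_lt hl hj))) hxl hx
  · rintro ⟨⟨j, hj, hx⟩, h⟩
    rcases hj.eq_or_lt with rfl | hlt
    · exact hx
    · exact absurd hx (h j hlt j le_rfl)

/-- The sets `C_i`, `I_i` are determined by `G` and `A`. -/
theorem unique (D D' : NeighborhoodLayering G A) : D = D' := by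
  have hcard : ∀ E : NeighborhoodLayering G A,
      E.k = ((fun x => G.neighborSet x) '' A).ncard := by
    intro E
    rw [← E.range_nbhd, ← Set.image_univ,
      Set.ncard_image_of_injective _ E.nbhd_strictMono.injective, Set.ncard_univ]
    simp
  have hk : D.k = D'.k := (hcard D).trans (hcard D').symm
  have hr : Set.range D.nbhd = Set.range D'.nbhd := D.range_nbhd.trans D'.range_nbhd.symm
  have hcl := D.cl_eq
  have hcl' := D'.cl_eq
  have hil := D.il_eq
  have hil' := D'.il_eq
  have hm := D.nbhd_strictMono
  have hm' := D'.nbhd_strictMono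
  generalize D.nbhd = f at *
  generalize D'.nbhd = g at *
  cases D
  cases D'
  dsimp only at *
  subst hk
  obtain rfl := (hm.range_inj hm').1 hr
  congr
  · funext i; rw [hcl, hcl']
  · funext i; rw [hil, hil']

end NeighborhoodLayering

/-- The nested property of `(π, A)` with respect to the clique `C`. -/
def HasNestedProperty {V : Type*} (G : SimpleGraph V) (C : Set V) (π : V → V → Prop)
    (A : Set V) : Prop :=
  (∀ x y, y ∈ C → Strict π x y → x ∈ C ∪ A) ∧
  ∃ D : NeighborhoodLayering G A,
    (∀ i, ∀ x y, y ∈ D.layer i → Strict π x y → ∃ j ≤ i, x ∈ D.layer j) ∧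
    (∀ i, {x | x ∈ D.il i ∧ ∃ y ∈ D.cl i, Strict π x y}.Subsingleton)

/-- The tuples that generate the nested partial order. -/
inductive NestedStep {V : Type*} (G : SimpleGraph V) (C I : Set V) (π : V → V → Prop)
    (A : Set V) : V → V → Prop
  | of_strict {x y : V} (h : Strict π x y) : NestedStep G C I π A x y
  | of_layer (D : NeighborhoodLayering G A) (i : Fin D.k) {x y : V} (hx : x ∈ D.layer i)
      (hy : ∀ j ≤ i, y ∉ D.layer j) : NestedStep G C I π A x y
  | of_clique {x y : V} (hx : x ∈ C) (hy : y ∈ I \ A) : NestedStep G C I π A x y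
  | of_premature (D : NeighborhoodLayering G A) (i : Fin D.k) {x y z : V} (hx : x ∈ D.il i)
      (hy : y ∈ D.il i) (hz : z ∈ D.cl i) (h : Strict π x z) : NestedStep G C I π A x y

/-- The nested partial order `π^N(π, A)`: the reflexive and transitive closure of the generating
tuples. -/
def nestedOrder {V : Type*} (G : SimpleGraph V) (C I : Set V) (π : V → V → Prop)
    (A : Set V) : V → V → Prop :=
  Relation.ReflTransGen (NestedStep G C I π A)

/-- The independent vertices `u` with `u ≺_π v` for some `v` with `v ∈ C` or `N(u) ⊊ N(v)`. -/
def forcedSet {V : Type*} (G : SimpleGraph V) (C I : Set V) (π : V → V → Prop) : Set V :=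
  {u | u ∈ I ∧ ∃ v, (v ∈ C ∨ G.neighborSet u ⊂ G.neighborSet v) ∧ Strict π u v}

/-- The relation on subsets of the clique `C` built from the neighbourhood differences of pairs
`x ≺_π y` in `I \ A` and from the restriction of the nested partial order to `C`. Subsets of `C`
are sets over the subtype `C`; for a split partition `N(x)` lies in `C` for every `x ∈ I`, so the
preimages below are the neighbourhood differences themselves. -/
def lbfsRel {V : Type*} (G : SimpleGraph V) (C I : Set V) (π : V → V → Prop) (A : Set V) :
    Set (Set C × Set C) :=
  {p | ∃ x ∈ I \ A, ∃ y ∈ I \ A, Strict π x y ∧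
      p.1 = (Subtype.val : C → V) ⁻¹' (G.neighborSet x \ G.neighborSet y) ∧
      p.2 = (Subtype.val : C → V) ⁻¹' (G.neighborSet y \ G.neighborSet x)} ∪
  {p | ∃ x y : C, Strict (nestedOrder G C I π A) (x : V) (y : V) ∧ p = ({x}, {y})}

end Nested

end SplitLBFS

namespace SplitLBFS

/-! ### LBFS orderings via a four point condition -/

section FourPoint

/-! LBFS orderings are exactly the orderings satisfying the four point condition `FourPoint`, so
both directions argue about linear orders on `V`.

Necessity. Call `u ∈ I` premature if some clique vertex follows it. All neighbours of `u` lie in the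
clique and hence see that later clique vertex, so the label of `u` can never beat its label.
Therefore `u` sees every clique vertex before it, and no independent vertex before `u` sees a clique
vertex after `u`. Consequently the neighbourhood of a premature vertex is an initial segment of the
clique, and these neighbourhoods grow along the ordering. Every vertex of `forcedSet` is premature,
which gives the layering and the nested property. On `C ∪ A` the ordering respects the nested order,
and `exists_oneBeforeAll` supplies the One-Before-All condition for pairs in `I \ A`.

Sufficiency. Sort the vertices by the lexicographic `sortKey`: first the block of the layering, then
the place in the given clique order (an early independent vertex goes right after its last clique
predecessor), then for `I \ A` the neighbourhoods compared at the first clique vertex where they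
differ, and last a linear extension of `π`. The One-Before-All condition says exactly what is needed
for the third component not to contradict `π`. -/

/-- The four point condition that characterizes LBFS orderings. -/
def FourPoint {V : Type*} [LinearOrder V] (G : SimpleGraph V) : Prop :=
  ∀ ⦃a b c : V⦄, a < b → b < c → G.Adj a c → ¬ G.Adj a b → ∃ d < a, G.Adj d b ∧ ¬ G.Adj d c

/-- The label of `b` is not beaten by that of `c` exactly when every number in the second but not
the first is preceded by one in the first but not the second. -/
theorem isLBFSOrdering_iff {V : Type*} [Fintype V] (G : SimpleGraph V) (σ : VertexOrdering V) :
    IsLBFSOrdering G σ ↔ ∀ a b c, a < b → b < c → G.Adj (σ a) (σ c) → ¬ G.Adj (σ a) (σ b) →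
      ∃ d < a, G.Adj (σ d) (σ b) ∧ ¬ G.Adj (σ d) (σ c) := by
  have hmem : ∀ (i a : Fin (Fintype.card V)) (v : V),
      (a : ℕ) + 1 ∈ label G σ i v ↔ a < i ∧ G.Adj (σ a) v := by
    intro i a v
    constructor
    · rintro ⟨j, hj, hadj, hm⟩
      have : a = j := Fin.ext (by omega)
      subst this
      exact ⟨hj, hadj⟩
    · rintro ⟨h1, h2⟩
      exact ⟨a, h1, h2, rfl⟩
  constructor
  · intro h a b c hab hbc hac hnab
    by_contra! hcon
    refine h b c hbc.le ?_
    have haT : (a : ℕ) + 1 ∈ label G σ b (σ c) \ label G σ b (σ b) :=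
      ⟨(hmem _ _ _).2 ⟨hab, hac⟩, fun h' => hnab ((hmem _ _ _).1 h').2⟩
    by_cases hsub : label G σ b (σ b) ⊆ label G σ b (σ c)
    · exact Or.inl ⟨hsub, fun h' => haT.2 (h' haT.1)⟩
    · right
      obtain ⟨m, hm, hm'⟩ := Set.not_subset.1 hsub
      have hne : (label G σ b (σ b) \ label G σ b (σ c)).Nonempty := ⟨m, hm, hm'⟩
      refine ⟨sInf _, sInf _, ⟨Nat.sInf_mem hne, fun x hx => Nat.sInf_le hx⟩,
        ⟨Nat.sInf_mem ⟨_, haT⟩, fun x hx => Nat.sInf_le hx⟩, ?_⟩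
      -- The number of `a` bounds one minimum from above; without a witness `d` before `a`, the
      -- other minimum lies beyond `a`.
      refine lt_of_le_of_lt (Nat.sInf_le haT) ?_
      obtain ⟨⟨d, hd, hdadj, hdm⟩, hd'⟩ := Nat.sInf_mem hne
      rw [hdm] at hd' ⊢
      by_contra! hle
      rcases (show d ≤ a from by simpa using hle).lt_or_eq with hlt | rfl
      · exact hd' ((hmem _ _ _).2 ⟨hd, hcon d hlt hdadj⟩)
      · exact hnab hdadj
  · intro h i j hij hlt
    have key : ∀ m ∈ label G σ i (σ j) \ label G σ i (σ i),
        ∃ m' ∈ label G σ i (σ i) \ label G σ i (σ j), m' < m := by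
      rintro m ⟨⟨a, ha, hadj, rfl⟩, hm⟩
      have hne : i < j := lt_of_le_of_ne hij (by
        rintro rfl
        exact hm ((hmem _ _ _).2 ⟨ha, hadj⟩))
      obtain ⟨d, hd, h1, h2⟩ := h a i j ha hne hadj fun h' => hm ((hmem _ _ _).2 ⟨ha, h'⟩)
      exact ⟨d + 1, ⟨(hmem _ _ _).2 ⟨hd.trans ha, h1⟩, fun h' => h2 ((hmem _ _ _).1 h').2⟩,
        by simpa using hd⟩
    rcases hlt with hlt | ⟨a, b, ha, hb, hba⟩
    · obtain ⟨m, hm, hm'⟩ := Set.not_subset.1 hlt.2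
      obtain ⟨m', hm1, -⟩ := key m ⟨hm, hm'⟩
      exact hm1.2 (hlt.1 hm1.1)
    · obtain ⟨m', hm1, hm2⟩ := key b hb.1
      exact absurd (ha.2 hm1) (by omega)

theorem exists_isLBFSOrdering_iff {V : Type*} [Fintype V] (G : SimpleGraph V)
    (π : V → V → Prop) :
    (∃ σ : VertexOrdering V, IsLBFSOrdering G σ ∧ σ.Extends π) ↔
      ∃ _ : LinearOrder V, FourPoint G ∧ ∀ x y : V, Strict π x y → x < y := by
  constructor
  · rintro ⟨σ, h, hext⟩
    refine ⟨LinearOrder.lift' σ.symm σ.symm.injective, ?_, fun x y hxy => hext x y hxy⟩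
    intro a b c hab hbc hac hnab
    obtain ⟨d, hd, h1, h2⟩ := (isLBFSOrdering_iff G σ).1 h (σ.symm a) (σ.symm b) (σ.symm c)
      hab hbc (by simpa using hac) (by simpa using hnab)
    refine ⟨σ d, ?_, by simpa using h1, by simpa using h2⟩
    change σ.symm (σ d) < σ.symm a
    simpa using hd
  · rintro ⟨L, h, hext⟩
    let e : Fin (Fintype.card V) ≃o V := Fintype.orderIsoFinOfCardEq V rfl
    refine ⟨e.toEquiv, (isLBFSOrdering_iff G _).2 ?_, fun x y hxy => ?_⟩
    · intro a b c hab hbc hac hnab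
      obtain ⟨d, hd, h1, h2⟩ := h (e.lt_iff_lt.2 hab) (e.lt_iff_lt.2 hbc) hac hnab
      refine ⟨e.symm d, ?_, ?_, ?_⟩
      · rw [← e.lt_iff_lt]
        simpa using hd
      · change G.Adj (e (e.symm d)) (e b)
        simpa using h1
      · change ¬ G.Adj (e (e.symm d)) (e c)
        simpa using h2
    · exact e.symm.lt_iff_lt.2 (hext x y hxy)

end FourPoint

/-! ### Split partitions and layerings of chains of neighbourhoods -/

section Layering

variable {V : Type*} {G : SimpleGraph V} {A C I : Set V}

namespace IsSplitPartition

theorem mem_or (hs : IsSplitPartition G C I) (v : V) : v ∈ C ∨ v ∈ I := by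
  have : v ∈ C ∪ I := hs.union_eq ▸ Set.mem_univ v
  exact this

theorem not_mem (hs : IsSplitPartition G C I) {v : V} (h : v ∈ C) : v ∉ I :=
  Set.disjoint_left.1 hs.disjoint h

theorem adj (hs : IsSplitPartition G C I) {u v : V} (hu : u ∈ C) (hv : v ∈ C) (h : u ≠ v) :
    G.Adj u v :=
  hs.clique hu hv h

theorem not_adj (hs : IsSplitPartition G C I) {u v : V} (hu : u ∈ I) (hv : v ∈ I) :
    ¬ G.Adj u v :=
  fun h => hs.indep hu hv h.ne h

theorem mem_of_adj (hs : IsSplitPartition G C I) {u v : V} (hu : u ∈ I) (h : G.Adj u v) :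
    v ∈ C :=
  (hs.mem_or v).resolve_right fun hv => hs.not_adj hu hv h

end IsSplitPartition

namespace NeighborhoodLayering

theorem adj_iff (D : NeighborhoodLayering G A) {i : Fin D.k} {x : V} (hx : x ∈ D.il i) (y : V) :
    G.Adj x y ↔ ∃ j ≤ i, y ∈ D.cl j := by
  have := Set.ext_iff.1 (D.neighborSet_eq i x hx) y
  simpa using this

theorem mem_iff (D : NeighborhoodLayering G A) (x : V) : x ∈ A ↔ ∃ i, x ∈ D.il i := by
  have := Set.ext_iff.1 D.iUnion_il x
  rw [← this, Set.mem_iUnion]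

theorem adj_of_mem (D : NeighborhoodLayering G A) {i j : Fin D.k} {x y : V} (hx : x ∈ D.il i)
    (hy : y ∈ D.cl j) : G.Adj x y ↔ j ≤ i := by
  rw [D.adj_iff hx]
  constructor
  · rintro ⟨l, hl, hyl⟩
    by_contra hne
    exact Set.disjoint_left.1 (D.cl_disjoint l j (by rintro rfl; exact hne hl)) hyl hy
  · exact fun h => ⟨j, h, hy⟩

theorem cl_subset (D : NeighborhoodLayering G A) (hs : IsSplitPartition G C I) (hA : A ⊆ I)
    (i : Fin D.k) : D.cl i ⊆ C := by
  intro y hy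
  obtain ⟨x, hx⟩ := D.il_nonempty i
  exact hs.mem_of_adj (hA ((D.mem_iff x).2 ⟨i, hx⟩)) ((D.adj_of_mem hx hy).2 le_rfl)

theorem layer_unique (D : NeighborhoodLayering G A) {i j : Fin D.k} {x : V}
    (hi : x ∈ D.layer i) (hj : x ∈ D.layer j) : i = j := by
  by_contra hne
  rcases hi with hi | hi <;> rcases hj with hj | hj
  · exact Set.disjoint_left.1 (D.cl_disjoint i j hne) hi hj
  · exact Set.disjoint_left.1 (D.cl_il_disjoint i j) hi hj
  · exact Set.disjoint_left.1 (D.cl_il_disjoint j i) hj hi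
  · exact Set.disjoint_left.1 (D.il_disjoint i j hne) hi hj

end NeighborhoodLayering

/-- In a chain, degree determines the neighbourhood. So `I_i` collects the vertices of the `i`-th
smallest degree in `A`, and `C_i` the vertices whose neighbours in `A` of least degree have that
degree. -/
theorem nonempty_neighborhoodLayering [Finite V] (hs : IsSplitPartition G C I) (hA : A ⊆ I)
    (hne : ∀ u ∈ A, (G.neighborSet u).Nonempty)
    (hchain : ∀ u ∈ A, ∀ w ∈ A,
      G.neighborSet u ⊆ G.neighborSet w ∨ G.neighborSet w ⊆ G.neighborSet u) :
    Nonempty (NeighborhoodLayering G A) := by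
  classical
  let f : V → ℕ := fun u => (G.neighborSet u).ncard
  have hmono : ∀ u ∈ A, ∀ w ∈ A, f u ≤ f w → G.neighborSet u ⊆ G.neighborSet w := by
    intro u hu w hw h
    rcases hchain u hu w hw with h' | h'
    · exact h'
    · exact (Set.eq_of_subset_of_ncard_le h' h).symm.subset
  have hfin : (f '' A).Finite := Set.toFinite _
  let s : Finset ℕ := hfin.toFinset
  let e : Fin s.card ↪o ℕ := s.orderEmbOfFin rfl
  have he : ∀ u ∈ A, ∃ i, e i = f u := by
    intro u hu
    have : f u ∈ Set.range e := by
      rw [Finset.range_orderEmbOfFin]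
      simpa [s] using ⟨u, hu, rfl⟩
    exact this
  have he' : ∀ i, ∃ u ∈ A, f u = e i := by
    intro i
    have : e i ∈ s := Finset.orderEmbOfFin_mem _ _ _
    simpa [s] using this
  let cl : Fin s.card → Set V := fun i =>
    {c | (∃ u ∈ A, f u = e i ∧ G.Adj u c) ∧ ∀ w ∈ A, f w < e i → ¬ G.Adj w c}
  let il : Fin s.card → Set V := fun i => {u | u ∈ A ∧ f u = e i}
  have hdis : ∀ i j, i < j → Disjoint (cl i) (cl j) := by
    intro i j hij
    rw [Set.disjoint_left]
    rintro c ⟨⟨u, hu, hfu, huc⟩, -⟩ ⟨-, h⟩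
    exact h u hu (hfu ▸ e.lt_iff_lt.2 hij) huc
  refine ⟨⟨s.card, cl, il, ?_, ?_, ?_, ?_, ?_, ?_, ?_⟩⟩
  -- If `C_i` were empty, every neighbour of `u ∈ I_i` would be seen by a vertex of smaller degree.
  -- The largest such neighbourhood would then contain that of `u`, against the degrees.
  -- Nonemptiness of the neighbourhood of `u` provides one such vertex.
  · intro i
    obtain ⟨u, hu, hfu⟩ := he' i
    by_contra hemp
    have hcov : ∀ c, G.Adj u c → ∃ w ∈ A, f w < f u ∧ G.Adj w c := by
      intro c hc
      by_contra! hcon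
      exact hemp ⟨c, ⟨u, hu, hfu, hc⟩, fun w hw hlt => hcon w hw (hfu ▸ hlt)⟩
    obtain ⟨c, hc⟩ := hne u hu
    obtain ⟨w₀, hw₀, hlt₀, -⟩ := hcov c hc
    obtain ⟨w, ⟨hw, hlt⟩, hmax⟩ := Set.exists_max_image {w | w ∈ A ∧ f w < f u} f
      (Set.toFinite _) ⟨w₀, hw₀, hlt₀⟩
    have hsub : G.neighborSet u ⊆ G.neighborSet w := by
      intro d hd
      obtain ⟨w', hw', hlt', had⟩ := hcov d hd
      exact hmono w' hw' w hw (hmax w' ⟨hw', hlt'⟩) had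
    exact absurd (Set.ncard_le_ncard hsub) (not_le.2 hlt)
  · intro i
    obtain ⟨u, hu, hfu⟩ := he' i
    exact ⟨u, hu, hfu⟩
  · intro i j hij
    rcases lt_or_gt_of_ne hij with h | h
    · exact hdis i j h
    · exact (hdis j i h).symm
  · intro i j hij
    rw [Set.disjoint_left]
    rintro c ⟨-, h1⟩ ⟨-, h2⟩
    exact hij (e.injective (h1.symm.trans h2))
  · intro i j
    rw [Set.disjoint_left]
    rintro c ⟨⟨u, hu, -, huc⟩, -⟩ ⟨h2, -⟩
    exact hs.not_adj (hA hu) (hA h2) huc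
  · ext u
    rw [Set.mem_iUnion]
    constructor
    · rintro ⟨i, h, -⟩
      exact h
    · intro h
      obtain ⟨i, hi⟩ := he u h
      exact ⟨i, h, hi.symm⟩
  · rintro i x ⟨hx, hfx⟩
    ext c
    simp only [Set.mem_iUnion, exists_prop]
    constructor
    · intro hc
      obtain ⟨w, ⟨hw, hwc⟩, hmin⟩ := Set.exists_min_image {w | w ∈ A ∧ G.Adj w c} f
        (Set.toFinite _) ⟨x, hx, hc⟩
      obtain ⟨j, hj⟩ := he w hw
      refine ⟨j, ?_, ⟨w, hw, hj.symm, hwc⟩, fun w' hw' hlt had => ?_⟩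
      · rw [← e.le_iff_le, hj, ← hfx]
        exact hmin x ⟨hx, hc⟩
      · exact absurd (hmin w' ⟨hw', had⟩) (by rw [← hj]; exact not_le.2 hlt)
    · rintro ⟨j, hj, ⟨u, hu, hfu, huc⟩, -⟩
      exact hmono u hu x hx (by rw [hfu, hfx]; exact e.le_iff_le.2 hj) huc

end Layering

/-! ### Necessity: premature vertices in an LBFS ordering -/

section Necessity

variable {V : Type*} {G : SimpleGraph V} {C I : Set V} {π : V → V → Prop}

theorem forcedSet_subset : forcedSet G C I π ⊆ I := fun _ h => h.1

theorem mem_forcedSet_of_clique {x y : V} (hx : x ∈ I) (hy : y ∈ C) (h : Strict π x y) :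
    x ∈ forcedSet G C I π :=
  ⟨hx, y, Or.inl hy, h⟩

variable [LinearOrder V]

namespace FourPoint

theorem adj_of_lt_premature (hF : FourPoint G) (hs : IsSplitPartition G C I) {u c d : V}
    (hu : u ∈ I) (hc : c ∈ C) (huc : u < c) (hd : d ∈ C) (hdu : d < u) : G.Adj u d := by
  by_contra hnot
  obtain ⟨e, he, h1, h2⟩ := hF hdu huc (hs.adj hd hc (hdu.trans huc).ne) fun h => hnot h.symm
  exact h2 (hs.adj (hs.mem_of_adj hu h1.symm) hc (he.trans (hdu.trans huc)).ne)

theorem not_adj_of_lt_premature (hF : FourPoint G) (hs : IsSplitPartition G C I) {u c w : V}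
    (hu : u ∈ I) (hc : c ∈ C) (huc : u < c) (hw : w ∈ I) (hwu : w < u) : ¬ G.Adj w c := by
  intro hadj
  obtain ⟨e, he, h1, h2⟩ := hF hwu huc hadj (hs.not_adj hw hu)
  exact h2 (hs.adj (hs.mem_of_adj hu h1.symm) hc (he.trans (hwu.trans huc)).ne)

/-- For `x` after `u`, a four point witness against `x` would be an independent vertex before `u`
seeing `x`, which prematurity of `u` excludes. -/
theorem adj_of_lt_of_adj (hF : FourPoint G) (hs : IsSplitPartition G C I) {u c x y : V}
    (hu : u ∈ I) (hc : c ∈ C) (huc : u < c) (hx : x ∈ C) (hy : y ∈ C) (hxy : x < y)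
    (hadj : G.Adj u y) : G.Adj u x := by
  rcases lt_trichotomy x u with h | rfl | h
  · exact hF.adj_of_lt_premature hs hu hc huc hx h
  · exact absurd hu (hs.not_mem hx)
  · by_contra hnot
    obtain ⟨e, he, h1, h2⟩ := hF h hxy hadj hnot
    rcases hs.mem_or e with heC | heI
    · exact h2 (hs.adj heC hy (he.trans (h.trans hxy)).ne)
    · exact hF.not_adj_of_lt_premature hs hu hx h heI he h1

theorem neighborSet_subset (hF : FourPoint G) (hs : IsSplitPartition G C I) {u w c : V}
    (hu : u ∈ I) (hw : w ∈ I) (huw : u < w) (hc : c ∈ C) (hwc : w < c) :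
    G.neighborSet u ⊆ G.neighborSet w := by
  intro d hd
  have hdC := hs.mem_of_adj hu hd
  rcases lt_trichotomy d w with h | rfl | h
  · exact hF.adj_of_lt_premature hs hw hc hwc hdC h
  · exact absurd hw (hs.not_mem hdC)
  · exact absurd hd (hF.not_adj_of_lt_premature hs hw hdC h hu huw)

/-- Forced vertices are premature. If `N(u) ⊊ N(v)`, a neighbour `d` of `v` missed by `u` must
follow `u`, since otherwise `u` would need a neighbour outside `N(v)` to be visited before `v`. -/
theorem exists_lt_of_mem_forcedSet (hF : FourPoint G) (hs : IsSplitPartition G C I)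
    (hext : ∀ x y, Strict π x y → x < y) {u : V} (hu : u ∈ forcedSet G C I π) :
    ∃ c ∈ C, u < c := by
  obtain ⟨huI, v, hv, huv⟩ := hu
  have hlt := hext u v huv
  rcases hs.mem_or v with hvC | hvI
  · exact ⟨v, hvC, hlt⟩
  · obtain ⟨hsub, hnot⟩ := hv.resolve_left fun h => hs.not_mem h hvI
    obtain ⟨d, hd, hd'⟩ := Set.not_subset.1 hnot
    have hdC := hs.mem_of_adj hvI hd
    refine ⟨d, hdC, ?_⟩
    rcases lt_trichotomy u d with h | rfl | h
    · exact h
    · exact absurd huI (hs.not_mem hdC)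
    · obtain ⟨e, -, h1, h2⟩ := hF h hlt (G.adj_symm hd) fun h => hd' (G.adj_symm h)
      exact absurd (hsub (G.adj_symm h1)) fun h => h2 (G.adj_symm h)

theorem nonempty_layering [Finite V] (hF : FourPoint G) (hG : G.Connected)
    (hs : IsSplitPartition G C I) (hext : ∀ x y, Strict π x y → x < y) :
    Nonempty (NeighborhoodLayering G (forcedSet G C I π)) := by
  refine nonempty_neighborhoodLayering hs forcedSet_subset ?_ ?_
  · intro u hu
    obtain ⟨c, -, hc⟩ := hF.exists_lt_of_mem_forcedSet hs hext hu
    have : Nontrivial V := ⟨u, c, hc.ne⟩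
    obtain ⟨v, hv⟩ := hG.preconnected.exists_adj_of_nontrivial u
    exact ⟨v, hv⟩
  · intro u hu w hw
    obtain ⟨c, hc, huc⟩ := hF.exists_lt_of_mem_forcedSet hs hext hu
    obtain ⟨d, hd, hwd⟩ := hF.exists_lt_of_mem_forcedSet hs hext hw
    rcases lt_trichotomy u w with h | rfl | h
    · exact Or.inl (hF.neighborSet_subset hs hu.1 hw.1 h hd hwd)
    · exact Or.inl subset_rfl
    · exact Or.inr (hF.neighborSet_subset hs hw.1 hu.1 h hc huc)

variable (D : NeighborhoodLayering G (forcedSet G C I π))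

theorem lt_of_il_of_il (hF : FourPoint G) (hs : IsSplitPartition G C I)
    (hext : ∀ x y, Strict π x y → x < y) {i j : Fin D.k} {x y : V} (hx : x ∈ D.il i)
    (hy : y ∈ D.il j) (hij : i < j) : x < y := by
  have hxF := (D.mem_iff x).2 ⟨i, hx⟩
  have hyF := (D.mem_iff y).2 ⟨j, hy⟩
  obtain ⟨c, hc, hxc⟩ := hF.exists_lt_of_mem_forcedSet hs hext hxF
  obtain ⟨e, he⟩ := D.cl_nonempty j
  have h2 : ¬ G.Adj x e := by rw [D.adj_of_mem hx he]; exact not_le.2 hij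
  have h1 : G.Adj y e := (D.adj_of_mem hy he).2 le_rfl
  rcases lt_trichotomy x y with h | rfl | h
  · exact h
  · exact absurd h1 h2
  · exact absurd (hF.neighborSet_subset hs hyF.1 hxF.1 h hc hxc h1) h2

/-- The restriction to `C ∪ A` is essential: an LBFS ordering may visit a vertex of `I \ A` earlier
than the nested order allows. -/
theorem lt_of_layer (hF : FourPoint G) (hs : IsSplitPartition G C I)
    (hext : ∀ x y, Strict π x y → x < y) {i : Fin D.k} {x y : V} (hx : x ∈ D.layer i)
    (hy : ∀ j ≤ i, y ∉ D.layer j) (hyC : y ∈ C ∪ forcedSet G C I π) : x < y := by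
  by_contra hle
  have hyx : y < x := lt_of_le_of_ne (not_lt.1 hle) (by rintro rfl; exact hy i le_rfl hx)
  rcases hyC with hyC | hyF
  · have hnadj : ∀ u ∈ D.il i, ¬ G.Adj u y := by
      intro u hu hadj
      obtain ⟨j, hj, hyj⟩ := (D.adj_iff hu y).1 hadj
      exact hy j hj (Or.inl hyj)
    rcases hx with hx | hx
    · obtain ⟨u, hu⟩ := D.il_nonempty i
      have huF := (D.mem_iff u).2 ⟨i, hu⟩
      obtain ⟨c, hc, huc⟩ := hF.exists_lt_of_mem_forcedSet hs hext huF
      exact hnadj u hu (hF.adj_of_lt_of_adj hs huF.1 hc huc hyC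
        (D.cl_subset hs forcedSet_subset i hx) hyx ((D.adj_of_mem hu hx).2 le_rfl))
    · have hxF := (D.mem_iff x).2 ⟨i, hx⟩
      obtain ⟨c, hc, hxc⟩ := hF.exists_lt_of_mem_forcedSet hs hext hxF
      exact hnadj x hx (hF.adj_of_lt_premature hs hxF.1 hc hxc hyC hyx)
  · obtain ⟨j, hj⟩ := (D.mem_iff y).1 hyF
    have hij : i < j := not_le.1 fun h => hy j h (Or.inr hj)
    rcases hx with hx | hx
    · obtain ⟨u, hu⟩ := D.il_nonempty i
      have huF := (D.mem_iff u).2 ⟨i, hu⟩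
      exact hF.not_adj_of_lt_premature hs hyF.1 (D.cl_subset hs forcedSet_subset i hx) hyx
        huF.1 (hF.lt_of_il_of_il D hs hext hu hj hij) ((D.adj_of_mem hu hx).2 le_rfl)
    · exact lt_asymm hyx (hF.lt_of_il_of_il D hs hext hx hj hij)

theorem mem_layer_of_strict (hF : FourPoint G) (hs : IsSplitPartition G C I)
    (hπ : IsPartialOrder V π) (hext : ∀ x y, Strict π x y → x < y) {i : Fin D.k} {x y : V}
    (hy : y ∈ D.layer i) (hxy : Strict π x y) : ∃ j ≤ i, x ∈ D.layer j := by
  by_contra! hcon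
  refine lt_asymm (hext x y hxy) (hF.lt_of_layer D hs hext hy hcon ?_)
  rcases hs.mem_or x with hxC | hxI
  · exact Or.inl hxC
  right
  rcases hy with hy | hy
  · exact mem_forcedSet_of_clique hxI (D.cl_subset hs forcedSet_subset i hy) hxy
  · have hyF := (D.mem_iff y).2 ⟨i, hy⟩
    obtain ⟨c, hc, hyc⟩ := hF.exists_lt_of_mem_forcedSet hs hext hyF
    obtain ⟨hyI, v, hv, hyv⟩ := hyF
    -- The reason that puts `y` in the forced set also applies to `x`, because `N(x) ⊆ N(y)`.
    have hxv : Strict π x v := ⟨hπ.trans _ _ _ hxy.1 hyv.1,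
      ((hext x y hxy).trans (hext y v hyv)).ne⟩
    exact ⟨hxI, v, hv.imp_right
      ((hF.neighborSet_subset hs hxI hyI (hext x y hxy) hc hyc).trans_ssubset ·), hxv⟩

theorem hasNestedProperty [Finite V] (hF : FourPoint G) (hG : G.Connected)
    (hs : IsSplitPartition G C I) (hπ : IsPartialOrder V π)
    (hext : ∀ x y, Strict π x y → x < y) : HasNestedProperty G C π (forcedSet G C I π) := by
  refine ⟨fun x y hy hxy => (hs.mem_or x).imp_right fun hx => mem_forcedSet_of_clique hx hy hxy,
    ?_⟩
  obtain ⟨D⟩ := hF.nonempty_layering hG hs hext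
  refine ⟨D, fun i x y hy hxy => hF.mem_layer_of_strict D hs hπ hext hy hxy, ?_⟩
  have key : ∀ i, ∀ x ∈ D.il i, ∀ x' ∈ D.il i, (∃ y ∈ D.cl i, Strict π x' y) → ¬ x < x' := by
    rintro i x hx x' hx' ⟨y, hy, hxy⟩ hlt
    exact hF.not_adj_of_lt_premature hs ((D.mem_iff x').2 ⟨i, hx'⟩).1
      (D.cl_subset hs forcedSet_subset i hy) (hext _ _ hxy) ((D.mem_iff x).2 ⟨i, hx⟩).1 hlt
      ((D.adj_of_mem hx hy).2 le_rfl)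
  rintro i x ⟨hx, hx2⟩ x' ⟨hx', hx2'⟩
  exact le_antisymm (not_lt.1 (key i x' hx' x hx hx2)) (not_lt.1 (key i x hx x' hx' hx2'))

/-- `C ∪ A` is closed under predecessors, so a chain of steps ending there stays inside, where every
generating pair agrees with the ordering. -/
theorem le_of_nestedStep (hF : FourPoint G) (hs : IsSplitPartition G C I)
    (hπ : IsPartialOrder V π) (hext : ∀ x y, Strict π x y → x < y) {x y : V}
    (h : NestedStep G C I π (forcedSet G C I π) x y) (hy : y ∈ C ∪ forcedSet G C I π) :
    x ∈ C ∪ forcedSet G C I π ∧ x ≤ y := by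
  have hlayer : ∀ (D : NeighborhoodLayering G (forcedSet G C I π)) i, ∀ z ∈ D.layer i,
      z ∈ C ∪ forcedSet G C I π := fun D i z hz =>
    hz.imp (fun h => D.cl_subset hs forcedSet_subset i h) fun h => (D.mem_iff z).2 ⟨i, h⟩
  rcases h with h | ⟨D, i, hx, hy'⟩ | ⟨-, hy'⟩ | ⟨D, i, hx, hy', hz, h⟩
  · refine ⟨?_, (hext x y h).le⟩
    rcases hy with hy | hy
    · exact (hs.mem_or x).imp_right fun hx => mem_forcedSet_of_clique hx hy h
    · rcases hs.mem_or x with hxC | hxI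
      · exact Or.inl hxC
      obtain ⟨c, hc, hyc⟩ := hF.exists_lt_of_mem_forcedSet hs hext hy
      obtain ⟨hyI, v, hv, hyv⟩ := hy
      exact Or.inr ⟨hxI, v, hv.imp_right
        ((hF.neighborSet_subset hs hxI hyI (hext x y h) hc hyc).trans_ssubset ·),
        hπ.trans _ _ _ h.1 hyv.1, ((hext x y h).trans (hext y v hyv)).ne⟩
  · exact ⟨hlayer D i x hx, (hF.lt_of_layer D hs hext hx hy' hy).le⟩
  · exact absurd hy (not_or.2 ⟨fun h => hs.not_mem h hy'.1, hy'.2⟩)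
  · refine ⟨hlayer D i x (Or.inr hx), ?_⟩
    by_contra hle
    exact hF.not_adj_of_lt_premature hs ((D.mem_iff x).2 ⟨i, hx⟩).1
      (D.cl_subset hs forcedSet_subset i hz) (hext _ _ h) ((D.mem_iff y).2 ⟨i, hy'⟩).1
      (not_le.1 hle) ((D.adj_of_mem hy' hz).2 le_rfl)

theorem le_of_nestedOrder (hF : FourPoint G) (hs : IsSplitPartition G C I)
    (hπ : IsPartialOrder V π) (hext : ∀ x y, Strict π x y → x < y) {x y : V}
    (h : nestedOrder G C I π (forcedSet G C I π) x y) (hy : y ∈ C ∪ forcedSet G C I π) :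
    x ≤ y := by
  have : x ∈ C ∪ forcedSet G C I π ∧ x ≤ y := by
    induction h using Relation.ReflTransGen.head_induction_on with
    | refl => exact ⟨hy, le_rfl⟩
    | head hstep _ ih =>
      obtain ⟨h1, h2⟩ := hF.le_of_nestedStep hs hπ hext hstep ih.1
      exact ⟨h1, h2.trans ih.2⟩
  exact this.2

/-- Let `d` be the first vertex of `N(y) \ N(x)`. If `d` precedes `x`, the four point condition
gives the witness. Otherwise `x` is premature, so `N(x)` is an initial segment of the clique ending
before `d`, and any element of `N(x) \ N(y)` works. -/
theorem exists_oneBeforeAll [Finite V] (hF : FourPoint G) (hs : IsSplitPartition G C I)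
    {x y : V} (hx : x ∈ I) (hy : y ∈ I)
    (hlt : x < y) (hnot : ¬ G.neighborSet x ⊂ G.neighborSet y)
    (hne : (G.neighborSet y \ G.neighborSet x).Nonempty) :
    ∃ e ∈ G.neighborSet x \ G.neighborSet y, ∀ d ∈ G.neighborSet y \ G.neighborSet x,
      e < d := by
  obtain ⟨d, ⟨hdy, hdx⟩, hmin⟩ := Set.exists_min_image _ id (Set.toFinite _) hne
  have hdC := hs.mem_of_adj hy hdy
  have hdx' : ¬ G.Adj x d := hdx
  suffices h : ∃ e ∈ G.neighborSet x \ G.neighborSet y, e < d by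
    obtain ⟨e, he, hed⟩ := h
    exact ⟨e, he, fun d' hd' => hed.trans_le (hmin d' hd')⟩
  rcases lt_trichotomy d x with h | rfl | h
  · obtain ⟨e, he, h1, h2⟩ := hF h hlt (G.adj_symm hdy) fun h => hdx (G.adj_symm h)
    exact ⟨e, ⟨G.adj_symm h1, fun h => h2 (G.adj_symm h)⟩, he⟩
  · exact absurd hx (hs.not_mem hdC)
  · have hns : ¬ G.neighborSet x ⊆ G.neighborSet y := fun h' =>
      hnot ⟨h', fun h'' => hdx (h'' hdy)⟩
    obtain ⟨e, he, he'⟩ := Set.not_subset.1 hns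
    refine ⟨e, ⟨he, he'⟩, ?_⟩
    rcases lt_trichotomy e d with h' | rfl | h'
    · exact h'
    · exact absurd he hdx
    · exact absurd (hF.adj_of_lt_of_adj hs hx hdC h hdC (hs.mem_of_adj hx he) h' he) hdx'

theorem isOBAOrdering [Finite V] (hF : FourPoint G) (hs : IsSplitPartition G C I)
    (hπ : IsPartialOrder V π) (hext : ∀ x y, Strict π x y → x < y) :
    IsOBAOrdering (groundSet (lbfsRel G C I π (forcedSet G C I π)))
      (lbfsRel G C I π (forcedSet G C I π)) (fun x y : C => (x : V) < y) := by
  refine ⟨inferInstanceAs (IsStrictTotalOrder C (· < ·)), ?_⟩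
  rintro X - Y - (⟨x, hx, y, hy, hxy, h1, h2⟩ | ⟨x, y, hxy, h⟩) hne
  · dsimp only at h1 h2
    subst h1 h2
    obtain ⟨d, hd⟩ := hne
    obtain ⟨e, he, hmin⟩ := hF.exists_oneBeforeAll hs hx.1 hy.1 (hext x y hxy)
      (fun h => hx.2 ⟨hx.1, y, Or.inr h, hxy⟩) ⟨d, hd⟩
    exact ⟨⟨e, hs.mem_of_adj hx.1 he.1⟩, he, fun d' hd' => hmin d' hd'⟩
  · obtain ⟨rfl, rfl⟩ := Prod.mk.inj h
    refine ⟨x, rfl, ?_⟩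
    rintro z rfl
    exact lt_of_le_of_ne (hF.le_of_nestedOrder hs hπ hext hxy.1 (Or.inl z.2)) hxy.2

end FourPoint

end Necessity

/-! ### Sufficiency: blocks and ranks -/

section Sufficiency

theorem exists_rank {V : Type*} [Finite V] {π : V → V → Prop} (hπ : IsPartialOrder V π) :
    ∃ ρ : V → ℕ, Function.Injective ρ ∧ ∀ x y, Strict π x y → ρ x < ρ y := by
  obtain ⟨s, hs, hle⟩ := extend_partialOrder π
  have hlt : ∀ x y, s x y → x ≠ y → {z | s z x}.ncard < {z | s z y}.ncard := by
    intro x y hxy hne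
    refine Set.ncard_lt_ncard ⟨fun z hz => hs.trans _ _ _ hz hxy, fun h => ?_⟩ (Set.toFinite _)
    exact hne (hs.antisymm _ _ hxy (h (hs.refl y)))
  refine ⟨fun y => {z | s z y}.ncard, fun x y hxy => ?_, fun x y h => hlt x y (hle _ _ h.1) h.2⟩
  by_contra hne
  rcases hs.total x y with h | h
  · exact (hlt x y h hne).ne hxy
  · exact (hlt y x h (Ne.symm hne)).ne hxy.symm

variable {V : Type*} {G : SimpleGraph V} {A C I : Set V} {π : V → V → Prop}

namespace NeighborhoodLayering

/-- `x` lies in some `I_i` and precedes an element of `C_i`. -/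
def Early (D : NeighborhoodLayering G A) (π : V → V → Prop) (x : V) : Prop :=
  ∃ i, x ∈ D.il i ∧ ∃ y ∈ D.cl i, Strict π x y

open Classical in
/-- The block of a vertex: the blocks are `C_i` with the early vertex of `I_i`, the rest of `I_i`,
the clique vertices outside the layers, and the independent vertices outside the layers. -/
noncomputable def stage (D : NeighborhoodLayering G A) (I : Set V) (π : V → V → Prop) (v : V) : ℕ :=
  if h : ∃ i, v ∈ D.layer i then 2 * (h.choose : ℕ) + if v ∈ I ∧ ¬ D.Early π v then 1 else 0
  else if v ∈ I then 2 * D.k + 2 else 2 * D.k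

open Classical in
theorem stage_of_mem (D : NeighborhoodLayering G A) {i : Fin D.k} {v : V} (h : v ∈ D.layer i) :
    D.stage I π v = 2 * (i : ℕ) + if v ∈ I ∧ ¬ D.Early π v then 1 else 0 := by
  have hex : ∃ i, v ∈ D.layer i := ⟨i, h⟩
  rw [stage, dif_pos hex, D.layer_unique hex.choose_spec h]

theorem stage_of_mem_cl (D : NeighborhoodLayering G A) (hs : IsSplitPartition G C I)
    (hA : A ⊆ I) {i : Fin D.k} {v : V} (h : v ∈ D.cl i) : D.stage I π v = 2 * (i : ℕ) := by
  rw [D.stage_of_mem (Or.inl h), if_neg fun h' => hs.not_mem (D.cl_subset hs hA i h) h'.1]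
  rfl

theorem stage_of_early (D : NeighborhoodLayering G A) {i : Fin D.k} {v : V} (h : v ∈ D.il i)
    (hv : D.Early π v) : D.stage I π v = 2 * (i : ℕ) := by
  rw [D.stage_of_mem (Or.inr h), if_neg fun h' => h'.2 hv]
  rfl

theorem stage_of_not_early (D : NeighborhoodLayering G A) (hA : A ⊆ I) {i : Fin D.k} {v : V}
    (h : v ∈ D.il i) (hv : ¬ D.Early π v) : D.stage I π v = 2 * (i : ℕ) + 1 := by
  rw [D.stage_of_mem (Or.inr h), if_pos ⟨hA ((D.mem_iff v).2 ⟨i, h⟩), hv⟩]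

/-- Each layer owns two consecutive values, so comparing stages compares layer indices; all of them
stay below `2 * D.k`. -/
theorem stage_of_mem_layer (D : NeighborhoodLayering G A) {i : Fin D.k} {v : V}
    (h : v ∈ D.layer i) : 2 * (i : ℕ) ≤ D.stage I π v ∧ D.stage I π v ≤ 2 * (i : ℕ) + 1 := by
  rw [D.stage_of_mem h]
  split_ifs <;> omega

theorem stage_of_rest (D : NeighborhoodLayering G A) (hs : IsSplitPartition G C I) {v : V}
    (hv : v ∈ C) (h : ∀ i, v ∉ D.cl i) (hA : A ⊆ I) : D.stage I π v = 2 * D.k := by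
  have hex : ¬ ∃ i, v ∈ D.layer i := by
    rintro ⟨i, h' | h'⟩
    · exact h i h'
    · exact hs.not_mem hv (hA ((D.mem_iff v).2 ⟨i, h'⟩))
  rw [stage, dif_neg hex, if_neg (hs.not_mem hv)]

theorem not_mem_layer (D : NeighborhoodLayering G A) (hs : IsSplitPartition G C I) (hA : A ⊆ I)
    {v : V} (hv : v ∈ I \ A) (i : Fin D.k) : v ∉ D.layer i := by
  rintro (h' | h')
  · exact hs.not_mem (D.cl_subset hs hA i h') hv.1
  · exact hv.2 ((D.mem_iff v).2 ⟨i, h'⟩)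

theorem stage_of_mem_diff (D : NeighborhoodLayering G A) (hs : IsSplitPartition G C I)
    (hA : A ⊆ I) {v : V} (hv : v ∈ I \ A) : D.stage I π v = 2 * D.k + 2 := by
  have hex : ¬ ∃ i, v ∈ D.layer i := fun ⟨i, h⟩ => D.not_mem_layer hs hA hv i h
  rw [stage, dif_neg hex, if_pos hv.1]

theorem stage_clique_le (D : NeighborhoodLayering G A) (hs : IsSplitPartition G C I)
    (hA : A ⊆ I) {v : V} (hv : v ∈ C) : D.stage I π v ≤ 2 * D.k := by
  by_cases h : ∃ i, v ∈ D.cl i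
  · obtain ⟨i, hi⟩ := h
    rw [D.stage_of_mem_cl hs hA hi]
    omega
  · rw [D.stage_of_rest hs hv (fun i hi => h ⟨i, hi⟩) hA]

end NeighborhoodLayering

/-! ### The lexicographic sorting key -/

section Key

open Classical in
/-- The missing neighbours of an independent vertex outside the layers. -/
noncomputable def missing (G : SimpleGraph V) (C I A : Set V) (v : V) : Lex (C → Bool) :=
  toLex fun c => decide (v ∈ I \ A ∧ ¬ G.Adj v c)

theorem missing_eq_of_not_mem {v w : V} (hv : v ∉ I \ A) (hw : w ∉ I \ A) :
    missing G C I A v = missing G C I A w := by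
  unfold missing
  congr 1
  funext c
  simp only [hv, hw, false_and]

theorem missing_eq_iff {v w : V} (hv : v ∈ I \ A) (hw : w ∈ I \ A) :
    missing G C I A v = missing G C I A w ↔ ∀ d : C, G.Adj v d ↔ G.Adj w d := by
  unfold missing
  rw [toLex_inj, funext_iff]
  simp only [hv, hw, true_and, decide_eq_decide, not_iff_not]

variable [LinearOrder C]

-- Since `false < true`, the smaller key belongs to the vertex that sees the first clique vertex of
-- disagreement.
open Classical in
theorem missing_lt_iff {v w : V} (hv : v ∈ I \ A) (hw : w ∈ I \ A) :
    missing G C I A v < missing G C I A w ↔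
      ∃ e : C, (∀ d < e, G.Adj v d ↔ G.Adj w d) ∧ G.Adj v e ∧ ¬ G.Adj w e := by
  change (∃ e : C, (∀ d, d < e → decide (v ∈ I \ A ∧ ¬ G.Adj v d) =
    decide (w ∈ I \ A ∧ ¬ G.Adj w d)) ∧ decide (v ∈ I \ A ∧ ¬ G.Adj v e) <
    decide (w ∈ I \ A ∧ ¬ G.Adj w e)) ↔ _
  simp only [hv, hw, true_and, decide_eq_decide, not_iff_not, Bool.lt_iff, decide_eq_false_iff_not,
    decide_eq_true_eq, not_not]

variable [Finite V]

open Classical in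
/-- Inside a block, the latest clique vertex that has to be visited no later. -/
noncomputable def slot (C : Set V) [LinearOrder C] (D : NeighborhoodLayering G A)
    (π : V → V → Prop) (v : V) : WithBot C :=
  letI := Fintype.ofFinite C
  if h : v ∈ C then ((⟨v, h⟩ : C) : WithBot C)
  else if D.Early π v then (Finset.univ.filter fun y : C => π y v).sup fun y => (y : WithBot C)
  else ⊥

theorem slot_clique (D : NeighborhoodLayering G A) (c : C) : slot C D π c = (c : WithBot C) :=
  dif_pos c.2

theorem slot_of_not_early (D : NeighborhoodLayering G A) (hs : IsSplitPartition G C I) {v : V}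
    (hv : v ∈ I) (h : ¬ D.Early π v) : slot C D π v = ⊥ := by
  rw [slot, dif_neg fun h' => hs.not_mem h' hv, if_neg h]

theorem le_slot (D : NeighborhoodLayering G A) (hs : IsSplitPartition G C I) {v : V}
    (hv : v ∈ I) (h : D.Early π v) {c : C} (hc : π c v) : (c : WithBot C) ≤ slot C D π v := by
  classical
  let := Fintype.ofFinite C
  rw [slot, dif_neg fun h' => hs.not_mem h' hv, if_pos h]
  exact Finset.le_sup (f := fun y : C => (y : WithBot C)) (by simpa using hc)

theorem slot_lt (D : NeighborhoodLayering G A) (hs : IsSplitPartition G C I) {v : V}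
    (hv : v ∈ I) (h : D.Early π v) {c : C} (hc : ∀ d : C, π d v → d < c) :
    slot C D π v < (c : WithBot C) := by
  classical
  let := Fintype.ofFinite C
  rw [slot, dif_neg fun h' => hs.not_mem h' hv, if_pos h,
    Finset.sup_lt_iff (WithBot.bot_lt_coe c)]
  intro d hd
  exact WithBot.coe_lt_coe.2 (hc d (by simpa using hd))

/-- The sorting key of a vertex. -/
noncomputable def sortKey (D : NeighborhoodLayering G A) (C I : Set V) [LinearOrder C]
    (π : V → V → Prop) (ρ : V → ℕ) (v : V) :
    ℕ ×ₗ WithBot C ×ₗ Lex (C → Bool) ×ₗ ℕ :=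
  toLex (D.stage I π v, toLex (slot C D π v, toLex (missing G C I A v, ρ v)))

theorem sortKey_lt_iff (D : NeighborhoodLayering G A) (ρ : V → ℕ) (v w : V) :
    sortKey D C I π ρ v < sortKey D C I π ρ w ↔
      D.stage I π v < D.stage I π w ∨ D.stage I π v = D.stage I π w ∧
        (slot C D π v < slot C D π w ∨ slot C D π v = slot C D π w ∧
          (missing G C I A v < missing G C I A w ∨ missing G C I A v = missing G C I A w ∧
            ρ v < ρ w)) := by
  simp only [sortKey, Prod.Lex.toLex_lt_toLex]

end Key

end Sufficiency

/-! ### The sorted order extends `π` and is an LBFS ordering -/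

section Sorting

variable {V : Type*} [Finite V] {G : SimpleGraph V} {A C I : Set V} {π : V → V → Prop}
  [LinearOrder C] (D : NeighborhoodLayering G A) {ρ : V → ℕ}

/-- The given clique order already runs through the `C_i` in turn and then the rest, because the
nested order prescribes this; so sorting by stage first does not disturb it. -/
theorem sortKey_clique_lt_iff (hs : IsSplitPartition G C I) (hA : A ⊆ I)
    (hτ : ∀ x y : C, Strict (nestedOrder G C I π A) (x : V) (y : V) → x < y) (c d : C) :
    sortKey D C I π ρ (c : V) < sortKey D C I π ρ (d : V) ↔ c < d := by
  have key : ∀ c d : C, c < d → sortKey D C I π ρ (c : V) < sortKey D C I π ρ (d : V) := by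
    intro c d hcd
    rw [sortKey_lt_iff, slot_clique, slot_clique]
    have hle : D.stage I π (c : V) ≤ D.stage I π (d : V) := by
      by_contra! hlt
      refine lt_asymm hcd (hτ d c ⟨Relation.ReflTransGen.single ?_,
        fun h => hcd.ne' (Subtype.ext h)⟩)
      by_cases hd : ∃ i, (d : V) ∈ D.cl i
      · obtain ⟨i, hi⟩ := hd
        refine NestedStep.of_layer D i (Or.inl hi) ?_
        rintro j hj (hc | hc)
        · rw [D.stage_of_mem_cl hs hA hi, D.stage_of_mem_cl hs hA hc] at hlt
          have : (j : ℕ) ≤ i := hj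
          omega
        · exact hs.not_mem c.2 (hA ((D.mem_iff _).2 ⟨j, hc⟩))
      · rw [D.stage_of_rest hs d.2 (fun i hi => hd ⟨i, hi⟩) hA] at hlt
        exact absurd (D.stage_clique_le hs hA c.2) (not_le.2 hlt)
    rcases hle.lt_or_eq with h | h
    · exact Or.inl h
    · exact Or.inr ⟨h, Or.inl (WithBot.coe_lt_coe.2 hcd)⟩
  refine ⟨fun h => ?_, key c d⟩
  rcases lt_trichotomy c d with h' | rfl | h'
  · exact h'
  · exact absurd h (lt_irrefl _)
  · exact absurd (key d c h') (lt_asymm h)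

theorem sortKey_lt_of_strict (hs : IsSplitPartition G C I) (hA : A ⊆ I)
    (hπ : IsPartialOrder V π)
    (hτ : ∀ x y : C, Strict (nestedOrder G C I π A) (x : V) (y : V) → x < y)
    (hρ : ∀ x y, Strict π x y → ρ x < ρ y)
    (h1 : ∀ x y, y ∈ C → Strict π x y → x ∈ C ∪ A)
    (h3 : ∀ i, ∀ x y, y ∈ D.layer i → Strict π x y → ∃ j ≤ i, x ∈ D.layer j)
    (h4 : ∀ i, {x | x ∈ D.il i ∧ ∃ y ∈ D.cl i, Strict π x y}.Subsingleton)
    (hoba : ∀ x ∈ I \ A, ∀ y ∈ I \ A, Strict π x y → (∃ d : C, G.Adj y d ∧ ¬ G.Adj x d) →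
      ∃ e : C, (G.Adj x e ∧ ¬ G.Adj y e) ∧ ∀ d : C, G.Adj y d → ¬ G.Adj x d → e < d)
    {x y : V} (hxy : Strict π x y) : sortKey D C I π ρ x < sortKey D C I π ρ y := by
  have hclA : ∀ v ∈ C, v ∉ I \ A := fun v hv h => hs.not_mem hv h.1
  have hilA : ∀ i, ∀ v ∈ D.il i, v ∉ I \ A := fun i v hv h => h.2 ((D.mem_iff v).2 ⟨i, hv⟩)
  have hil : ∀ i, ∀ v ∈ D.layer i, v ∈ I → v ∈ D.il i := fun i v hv hvI =>
    hv.resolve_left fun h => hs.not_mem (D.cl_subset hs hA i h) hvI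
  have hcl : ∀ i, ∀ v ∈ D.layer i, v ∈ C → v ∈ D.cl i := fun i v hv hvC =>
    hv.resolve_right fun h => hs.not_mem hvC (hA ((D.mem_iff v).2 ⟨i, h⟩))
  have hearly : ∀ v ∈ I \ A, ¬ D.Early π v := fun v hv ⟨i, h, _⟩ => hilA i v h hv
  have htrans : ∀ {u v w}, Strict π u v → Strict π v w → Strict π u w := fun {u v w} huv hvw =>
    ⟨hπ.trans _ _ _ huv.1 hvw.1, by
      rintro rfl
      exact huv.2 (hπ.antisymm _ _ huv.1 hvw.1)⟩
  rcases hs.mem_or y with hyC | hyI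
  · rcases hs.mem_or x with hxC | hxI
    · exact (sortKey_clique_lt_iff D hs hA hτ ⟨x, hxC⟩ ⟨y, hyC⟩).2
        (hτ ⟨x, hxC⟩ ⟨y, hyC⟩ ⟨Relation.ReflTransGen.single (NestedStep.of_strict hxy), hxy.2⟩)
    obtain ⟨i, hi⟩ := (D.mem_iff x).1 ((h1 x y hyC hxy).resolve_left fun h => hs.not_mem h hxI)
    have hst := D.stage_of_mem_layer (I := I) (π := π) (Or.inr hi)
    rw [sortKey_lt_iff]
    by_cases hy : ∃ j, y ∈ D.cl j
    · obtain ⟨j, hj⟩ := hy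
      have hyst := D.stage_of_mem_cl (π := π) hs hA hj
      obtain ⟨j', hj', hx⟩ := h3 j x y (Or.inl hj) hxy
      obtain rfl := D.layer_unique (Or.inr hi) hx
      rcases hj'.lt_or_eq with hlt | rfl
      · have : (i : ℕ) < j := hlt
        left
        omega
      · have hE : D.Early π x := ⟨i, hi, y, hj, hxy⟩
        refine Or.inr ⟨(D.stage_of_early hi hE).trans hyst.symm, Or.inl ?_⟩
        rw [slot_clique D ⟨y, hyC⟩]
        -- By transitivity, clique predecessors of `x` are also predecessors of `y`, so even the
        -- latest of them comes before `y`.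
        refine slot_lt D hs hxI hE fun d hd => hτ d ⟨y, hyC⟩ ?_
        have hdx : Strict π d x := ⟨hd, by
          rintro rfl
          exact hs.not_mem d.2 hxI⟩
        have hdy := htrans hdx hxy
        exact ⟨Relation.ReflTransGen.single (NestedStep.of_strict hdy), hdy.2⟩
    · left
      rw [D.stage_of_rest hs hyC (fun j hj => hy ⟨j, hj⟩) hA]
      have := i.2
      omega
  rw [sortKey_lt_iff]
  by_cases hyA : y ∈ A
  · obtain ⟨i, hi⟩ := (D.mem_iff y).1 hyA
    have hst := D.stage_of_mem_layer (I := I) (π := π) (Or.inr hi)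
    obtain ⟨j, hj, hx⟩ := h3 i x y (Or.inr hi) hxy
    have hji : (j : ℕ) ≤ i := hj
    rcases hs.mem_or x with hxC | hxI
    · have hxst := D.stage_of_mem_cl (π := π) hs hA (hcl j x hx hxC)
      by_cases hlt : D.stage I π x < D.stage I π y
      · exact Or.inl hlt
      refine Or.inr ⟨by omega, ?_⟩
      have hE : D.Early π y := by
        by_contra hE
        have := D.stage_of_not_early hA hi hE
        omega
      have hle := le_slot D hs hyI hE (c := ⟨x, hxC⟩) hxy.1
      rw [slot_clique D ⟨x, hxC⟩]
      -- A tie occurs when `x` itself is the latest clique predecessor of `y`; the rank then puts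
      -- `x` first.
      exact hle.lt_or_eq.imp_right fun h =>
        ⟨h, Or.inr ⟨missing_eq_of_not_mem (hclA x hxC) (hilA i y hi), hρ x y hxy⟩⟩
    · have hxl := hil j x hx hxI
      have hxst := D.stage_of_mem_layer (I := I) (π := π) hx
      rcases hj.lt_or_eq with hlt | rfl
      · have : (j : ℕ) < i := hlt
        left
        omega
      by_cases hxE : D.Early π x
      · left
        rw [D.stage_of_early hxl hxE]
        by_cases hyE : D.Early π y
        · obtain ⟨i, hi1, z, hz, hxz⟩ := hxE
          obtain ⟨i', hi1', z', hz', hyz⟩ := hyE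
          obtain rfl := D.layer_unique hx (Or.inr hi1)
          obtain rfl := D.layer_unique (Or.inr hi) (Or.inr hi1')
          exact absurd (h4 j ⟨hi1, z, hz, hxz⟩ ⟨hi1', z', hz', hyz⟩) hxy.2
        · rw [D.stage_of_not_early hA hi hyE]
          omega
      · have hyE : ¬ D.Early π y := by
          rintro ⟨i, hi1, z, hz, hyz⟩
          obtain rfl := D.layer_unique (Or.inr hi) (Or.inr hi1)
          exact hxE ⟨j, hxl, z, hz, htrans hxy hyz⟩
        right
        rw [D.stage_of_not_early hA hi hyE, D.stage_of_not_early hA hxl hxE,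
          slot_of_not_early D hs hxI hxE, slot_of_not_early D hs hyI hyE]
        exact ⟨rfl, Or.inr ⟨rfl, Or.inr
          ⟨missing_eq_of_not_mem (hilA j x hxl) (hilA j y hi), hρ x y hxy⟩⟩⟩
  · have hyst := D.stage_of_mem_diff (π := π) hs hA ⟨hyI, hyA⟩
    rcases hs.mem_or x with hxC | hxI
    · have := D.stage_clique_le (π := π) hs hA hxC
      left
      omega
    by_cases hxA : x ∈ A
    · obtain ⟨i, hi⟩ := (D.mem_iff x).1 hxA
      have hst := D.stage_of_mem_layer (I := I) (π := π) (Or.inr hi)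
      have := i.2
      left
      omega
    · right
      rw [hyst, D.stage_of_mem_diff (π := π) hs hA ⟨hxI, hxA⟩,
        slot_of_not_early D hs hxI (hearly x ⟨hxI, hxA⟩),
        slot_of_not_early D hs hyI (hearly y ⟨hyI, hyA⟩)]
      refine ⟨rfl, Or.inr ⟨rfl, ?_⟩⟩
      -- If the first disagreement `e` favoured `y`, One-Before-All would produce a disagreement
      -- before `e`.
      have hle : missing G C I A x ≤ missing G C I A y := by
        by_contra! hlt
        obtain ⟨e, he, hey, hex⟩ := (missing_lt_iff ⟨hyI, hyA⟩ ⟨hxI, hxA⟩).1 hlt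
        obtain ⟨e', ⟨he1, he2⟩, he3⟩ := hoba x ⟨hxI, hxA⟩ y ⟨hyI, hyA⟩ hxy ⟨e, hey, hex⟩
        exact he2 ((he e' (he3 e hey hex)).2 he1)
      exact hle.lt_or_eq.imp_right fun h => ⟨h, hρ x y hxy⟩

/-- Only `a ∈ C` with `b, c ∈ I \ A` can occur, and there the first disagreement between `N(b)` and
`N(c)` is the witness. For `b ∈ C` the layers force adjacency to `a`; for `a, b ∈ I` both would be
early in one layer, against (N4). -/
theorem sortKey_fourPoint (hs : IsSplitPartition G C I) (hA : A ⊆ I)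
    (hτ : ∀ x y : C, Strict (nestedOrder G C I π A) (x : V) (y : V) → x < y)
    (h4 : ∀ i, {x | x ∈ D.il i ∧ ∃ y ∈ D.cl i, Strict π x y}.Subsingleton) {a b c : V}
    (hab : sortKey D C I π ρ a < sortKey D C I π ρ b)
    (hbc : sortKey D C I π ρ b < sortKey D C I π ρ c) (hac : G.Adj a c) (hnab : ¬ G.Adj a b) :
    ∃ d, sortKey D C I π ρ d < sortKey D C I π ρ a ∧ G.Adj d b ∧ ¬ G.Adj d c := by
  have hstage : ∀ {v w}, sortKey D C I π ρ v < sortKey D C I π ρ w →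
      D.stage I π v ≤ D.stage I π w := by
    intro v w h
    rcases (sortKey_lt_iff D ρ v w).1 h with h | h
    · exact h.le
    · exact h.1.le
  have hsab := hstage hab
  have hsbc := hstage hbc
  have hmem : ∀ v ∈ I, D.stage I π v ≤ 2 * D.k → ∃ i, v ∈ D.il i := by
    intro v hv h
    rw [← D.mem_iff]
    by_contra hvA
    rw [D.stage_of_mem_diff hs hA ⟨hv, hvA⟩] at h
    omega
  rcases hs.mem_or b with hbC | hbI
  · have haI : a ∈ I := (hs.mem_or a).resolve_left fun haC =>
      hnab (hs.adj haC hbC (by rintro rfl; exact lt_irrefl _ hab))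
    have hb := D.stage_clique_le (π := π) hs hA hbC
    obtain ⟨i, hi⟩ := hmem a haI (hsab.trans hb)
    obtain ⟨j, hj, hcj⟩ := (D.adj_iff hi c).1 hac
    have hji : (j : ℕ) ≤ i := hj
    rw [D.stage_of_mem_cl hs hA hcj] at hsbc
    by_cases hbl : ∃ l, b ∈ D.cl l
    · obtain ⟨l, hl⟩ := hbl
      rw [D.stage_of_mem_cl hs hA hl] at hsbc
      exact absurd ((D.adj_of_mem hi hl).2 (show (l : ℕ) ≤ i by omega)) hnab
    · rw [D.stage_of_rest hs hbC (fun l hl => hbl ⟨l, hl⟩) hA] at hsbc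
      have := i.2
      omega
  rcases hs.mem_or a with haC | haI
  · have hbA : b ∉ A := by
      intro hbA
      obtain ⟨i, hi⟩ := (D.mem_iff b).1 hbA
      have hst := D.stage_of_mem_layer (I := I) (π := π) (Or.inr hi)
      by_cases hal : ∃ l, a ∈ D.cl l
      · obtain ⟨l, hl⟩ := hal
        rw [D.stage_of_mem_cl hs hA hl] at hsab
        exact hnab ((D.adj_of_mem hi hl).2 (show (l : ℕ) ≤ i by omega)).symm
      · rw [D.stage_of_rest hs haC (fun l hl => hal ⟨l, hl⟩) hA] at hsab
        have := i.2
        omega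
    have hb : b ∈ I \ A := ⟨hbI, hbA⟩
    have hbst := D.stage_of_mem_diff (π := π) hs hA hb
    have hc : c ∈ I \ A := by
      have hcI : c ∈ I := (hs.mem_or c).resolve_left fun hcC => by
        have := D.stage_clique_le (π := π) hs hA hcC
        omega
      refine ⟨hcI, fun hcA => ?_⟩
      obtain ⟨i, hi⟩ := (D.mem_iff c).1 hcA
      have hst := D.stage_of_mem_layer (I := I) (π := π) (Or.inr hi)
      have := i.2
      omega
    have hearly : ∀ v ∈ I \ A, ¬ D.Early π v := fun v hv ⟨i, h, _⟩ =>
      hv.2 ((D.mem_iff v).2 ⟨i, h⟩)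
    have hne : missing G C I A b ≠ missing G C I A c := fun h =>
      hnab (((missing_eq_iff hb hc).1 h ⟨a, haC⟩).2 hac.symm).symm
    rw [sortKey_lt_iff, hbst, D.stage_of_mem_diff (π := π) hs hA hc,
      slot_of_not_early D hs hbI (hearly b hb), slot_of_not_early D hs hc.1 (hearly c hc)] at hbc
    have hlt : missing G C I A b < missing G C I A c := by
      simpa [hne] using hbc
    obtain ⟨e, he, heb, hec⟩ := (missing_lt_iff hb hc).1 hlt
    refine ⟨e, ?_, heb.symm, fun h => hec h.symm⟩
    refine (sortKey_clique_lt_iff D hs hA hτ e ⟨a, haC⟩).2 ?_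
    rcases lt_trichotomy e ⟨a, haC⟩ with h | rfl | h
    · exact h
    · exact absurd heb.symm hnab
    · exact absurd ((he _ h).2 hac.symm).symm hnab
  · exfalso
    have hcC := hs.mem_of_adj haI hac
    have hc := D.stage_clique_le (π := π) hs hA hcC
    obtain ⟨i, hi⟩ := hmem b hbI (hsbc.trans hc)
    obtain ⟨i', hi'⟩ := hmem a haI (hsab.trans (hsbc.trans hc))
    obtain ⟨j, hj, hcj⟩ := (D.adj_iff hi' c).1 hac
    have hji : (j : ℕ) ≤ i' := hj
    rw [D.stage_of_mem_cl hs hA hcj] at hsbc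
    have hst := D.stage_of_mem_layer (I := I) (π := π) (Or.inr hi)
    have hst' := D.stage_of_mem_layer (I := I) (π := π) (Or.inr hi')
    have hii : i' = i := Fin.ext (by omega)
    subst hii
    have hE : ∀ v ∈ D.il i', D.stage I π v ≤ 2 * (i' : ℕ) → ∃ y ∈ D.cl i', Strict π v y := by
      intro v hv hle
      have : D.Early π v := by
        by_contra hE
        rw [D.stage_of_not_early hA hv hE] at hle
        omega
      obtain ⟨l, hl, h⟩ := this
      rwa [D.layer_unique (Or.inr hv) (Or.inr hl)]
    have := h4 i' ⟨hi', hE a hi' (by omega)⟩ ⟨hi, hE b hi (by omega)⟩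
    exact hab.ne (by rw [this])

end Sorting

theorem exists_fourPoint {V : Type*} [Finite V] {G : SimpleGraph V} {A C I : Set V}
    {π : V → V → Prop} (hs : IsSplitPartition G C I) (hA : A ⊆ I) (hπ : IsPartialOrder V π)
    (hN : HasNestedProperty G C π A) {τ : C → C → Prop}
    (hO : IsOBAOrdering (groundSet (lbfsRel G C I π A)) (lbfsRel G C I π A) τ) :
    ∃ _ : LinearOrder V, FourPoint G ∧ ∀ x y : V, Strict π x y → x < y := by
  classical
  obtain ⟨h1, D, h3, h4⟩ := hN
  obtain ⟨hsto, hO⟩ := hO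
  let := linearOrderOfSTO τ
  obtain ⟨ρ, hρi, hρ⟩ := exists_rank hπ
  have hO' : ∀ X Y, (X, Y) ∈ lbfsRel G C I π A → Y.Nonempty → ∃ x ∈ X, ∀ y ∈ Y, x < y :=
    fun X Y h => hO X ⟨Y, Or.inl h⟩ Y ⟨X, Or.inr h⟩ h
  have hτ : ∀ x y : C, Strict (nestedOrder G C I π A) (x : V) (y : V) → x < y := by
    intro x y hxy
    obtain ⟨x', rfl, h⟩ := hO' {x} {y} (Or.inr ⟨x, y, hxy, rfl⟩) ⟨y, rfl⟩
    exact h y rfl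
  have hoba : ∀ x ∈ I \ A, ∀ y ∈ I \ A, Strict π x y → (∃ d : C, G.Adj y d ∧ ¬ G.Adj x d) →
      ∃ e : C, (G.Adj x e ∧ ¬ G.Adj y e) ∧ ∀ d : C, G.Adj y d → ¬ G.Adj x d → e < d := by
    rintro x hx y hy hxy ⟨d, hd⟩
    obtain ⟨e, he, h⟩ := hO' _ _ (Or.inl ⟨x, hx, y, hy, hxy, rfl, rfl⟩) ⟨d, hd⟩
    exact ⟨e, he, fun d' h1 h2 => h d' ⟨h1, h2⟩⟩
  -- The last component alone already separates the vertices.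
  have hinj : Function.Injective (sortKey D C I π ρ) := fun v w h => hρi
    (congrArg (fun p => (ofLex (ofLex (ofLex p).2).2).2) h)
  refine ⟨LinearOrder.lift' (sortKey D C I π ρ) hinj, ?_, fun x y hxy => ?_⟩
  · intro a b c hab hbc hac hnab
    exact sortKey_fourPoint D hs hA hτ h4 hab hbc hac hnab
  · exact sortKey_lt_of_strict D hs hA hπ hτ hρ h1 h3 h4 hoba hxy

end SplitLBFS

theorem mainTheorem4 {V : Type*} [Fintype V] (G : SimpleGraph V) (hG : G.Connected)
    (C I : Set V) (hsplit : SplitLBFS.IsSplitPartition G C I)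
    (π : V → V → Prop) (hπ : IsPartialOrder V π) :
    (∃ σ : SplitLBFS.VertexOrdering V,
        SplitLBFS.IsLBFSOrdering G σ ∧ SplitLBFS.VertexOrdering.Extends σ π) ↔
      SplitLBFS.HasNestedProperty G C π (SplitLBFS.forcedSet G C I π) ∧
      ∃ τ : C → C → Prop,
        SplitLBFS.IsOBAOrdering
          (SplitLBFS.groundSet
            (SplitLBFS.lbfsRel G C I π (SplitLBFS.forcedSet G C I π)))
          (SplitLBFS.lbfsRel G C I π (SplitLBFS.forcedSet G C I π)) τ := by
  rw [SplitLBFS.exists_isLBFSOrdering_iff]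
  constructor
  · rintro ⟨L, hF, hext⟩
    exact ⟨hF.hasNestedProperty hG hsplit hπ hext, _, hF.isOBAOrdering hsplit hπ hext⟩
  · rintro ⟨hN, τ, hO⟩
    exact SplitLBFS.exists_fourPoint hsplit SplitLBFS.forcedSet_subset hπ hN hO
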